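/- **Programs.** Let $K\ge 2$. A finite-state shared memory concurrent program $Q=(St_Q,\,Q_1\|\cdots\|Q_K)$ consists of pairwise disjoint sets $AP_1,\dots,AP_K$ of atomic propositions, finitely many shared variables with finite domains, a set $St_Q$ of initial global states, and for each $i$ a directed multigraph $Q_i$ (a synchronization skeleton) with finitely many nodes, the local states $s_i$. Each local state carries a set $V_i(s_i)\subseteq AP_i$, with $V_i(s_i)\ne V_i(t_i)$ for $s_i\neq t_i$, and each arc carries a guarded command $B\to A$. A global state consists of one local state $s{\upharpoonright}i$ per process and a value $s(x)$ for each shared variable $x$. A transition $(s,i,s')$ executes one arc of $Q_i$ that starts at $s{\upharpoonright}i$ and whose guard holds in $s$: the local state of $i$ moves to the end of the arc, the action updates the shared variables, and nothing else changes. Put $AP=\bigcup_i AP_i$; a proposition $p\in AP_i$ is true in $s$ iff $p\in V_i(s{\upharpoonright}i)$. The global state transition diagram $M_Q=(St_Q,S_Q,R_Q)$ is the Kripke structure of the reachable global states with the transitions between them; diagrams of other programs are defined likewise. **Pairwise normal form.** Let $I$ be an irreflexive symmetric relation on $\{1,\dots,K\}$. In a program in pairwise normal form each shared variable belongs to one pair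 $\{i,j\}$ with $(i,j)\in I$. Each arc of process $i$ carries, for every neighbour $j$ of $i$, a finite list of alternative guarded commands; each of their guards reads only the variables of $\{i,j\}$ and the propositions in $AP_j$, and each of their actions updates only the variables of $\{i,j\}$. To execute the arc, one alternative with a true guard is selected for each neighbour, and all selected actions are executed simultaneously. **The program $PP$ built from $Q$.** Let $in\_procs(s)=\{i: \exists s'\ (s',i,s)\in R_Q\}$. Let $M'_Q$ be obtained from $M_Q$ by replacing each state $s$ by the copies $(s,i)$, $i\in in\_procs(s)$, or by the single copy $(s,1)$ if $in\_procs(s)=\emptyset$. All copies of initial states are initial, and each transition $(s,i,s')$ of $M_Q$ gives a transition labelled $i$ from every copy of $s$ to $(s',i)$. Order timestamps in $\{0,1,2\}$ cyclically by $0<_o1<_o2<_o0$. Let $step(t,t')$ be $t$ if $t'<_o t$, and otherwise the value $r$ with $t'<_o r$. Choose for each $i$ some $\ell_i\ne i$. A local state of $PP_i$ is a local state of $Q_i$, whose true atomic propositions it inherits, together with timestamps $t_i^1,\dots,t_i^K$. All pairs of distinct processes are neighbours. Process $i$ writes, for each $j\ne i$, copies $x_{ij}^i$ of all shared variables $x$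 of $Q$ and a timestamp vector $tv_{ij}^i\in\{0,1,2\}^K$ (with entries $tv_{ij}^i.k$); these are shared by $i$ and $j$. It also writes $x_{ii}^i$ and $tv_{ii}^i$, which are shared by $i$ and $\ell_i$. The order of the two subscripts is immaterial. The initial states of $PP$ correspond one to one to the initial states $u=(s,c)$ of $M'_Q$: local states and all copies of variables are as in $s$, $t_c^j=1$ and $t_j^c=0$ for $j\ne c$, all other timestamps are arbitrary, and $tv_{ij}^i=(t_i^1,\dots,t_i^K)$. For every transition from $(s,c)$ to $(s',i)$ in $M'_Q$, all $d,d'\in\{0,1,2\}^K$ and all $m\in\{0,1,2\}^K$, $PP_i$ has an arc from $(s{\upharpoonright}i,d)$ to $(s'{\upharpoonright}i,d')$, with one guarded command for each $j\neq i$: - its guard says that process $j$ has the atomic propositions of $s{\upharpoonright}j$, that $step(d_j,tv_{ji}^j.i)=d'_j$, and that $L_j$ holds, and, if $j=\ell_i$, that also $L_i$ holds. Here, for $k\ne c$, $L_k$ is $tv_{ki}^k.c=m_k$, and $L_c$ says that $tv_{ci}^c.k=m_k+1 \pmod 3$ for all $k\ne c$ and $x_{ci}^c=s(x)$ for all $x$.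 (The disjunction over $m$ of $\bigwedge_k L_k$ says that $tv_{ci}^c.k>_o tv_{ki}^k.c$ for all $k\neq c$ and that $x_{ci}^c=s(x)$ for all $x$.) - its action sets $x_{ij}^i:=s'(x)$ for all $x$, and sets $tv_{ij}^i$ to $d'$ with $j$-th entry $step(d_j,tv_{ji}^j.i)$; if $j=\ell_i$, it makes the same assignments to $x_{ii}^i$ and $tv_{ii}^i$. Thus $PP$ is in pairwise normal form. Let $M_{PP}$ be its global state transition diagram. **CTL\*.** Formulas of CTL$^*$ over $AP$ are the state formulas $f ::= \mathit{true}\mid p\mid \neg f\mid f\wedge f\mid \mathsf E g$ with path formulas $g ::= f\mid \neg g\mid g\wedge g\mid \mathsf X g\mid g\,\mathsf U\,g$, with the usual semantics over fullpaths. For a Kripke structure $M$, write $M\models f$ if $M,s\models f$ for all initial states $s$. **Corollary.** For every such $Q$, all the above choices in the construction of $PP$, and every CTL$^*$ formula $f$ over $AP$, $$M_Q\models f\iff M_{PP}\models f .$$ This holds both if fullpaths are the infinite paths and if fullpaths are the maximal paths (the infinite ones, and the finite ones that end in a state without successor). -/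

import Mathlib

open Function

universe u v w

/-! ## Kripke structures and global state transition diagrams -/

/-- A Kripke structure `(St, S, R)` over atomic propositions `A`, with transitions labelled by process
indices in `ι`; `label s` is the set of propositions that are true in `s`. -/
structure Kripke (ι : Type v) (A : Type u) where
  State : Type w
  init : Set State
  states : Set State
  trans : State → ι → State → Prop
  label : State → Set A

/-- The smallest set of states that contains `init` and is closed under `next`. -/
inductive Reachable {ι : Type v} {σ : Type w} (init : Set σ) (next : σ → ι → σ → Prop) : σ → Prop
  | init {s : σ} : s ∈ init → Reachable init next s
  | step {s t : σ} {i : ι} : Reachable init next s → next s i t → Reachable init next t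

/-- The global state transition diagram: the reachable states, and the next-state relation restricted
to them. -/
def gstd {ι : Type v} {A : Type u} {σ : Type w} (init : Set σ) (next : σ → ι → σ → Prop)
    (label : σ → Set A) : Kripke ι A where
  State := σ
  init := init
  states := {s | Reachable init next s}
  trans s i t := Reachable init next s ∧ Reachable init next t ∧ next s i t
  label := label

/-! ## Finite-state shared memory concurrent programs -/

/-- A global state: the local states of the processes and the values of the shared variables. -/
@[ext]
structure GlobalState {K : ℕ} (Loc : Fin K → Type u) {Var : Type v} (Dom : Var → Type w) where
  loc : ∀ i, Loc i
  var : ∀ x, Dom x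

/-- A guarded command `guard → action`: it reads an `r : R`, and its action computes the new values
`W` of the variables that it may update. -/
structure GuardedCommand (R : Type u) (W : Type v) where
  guard : R → Prop
  action : R → W

/-- An arc between local states `src` and `dst`, labelled with a command. -/
structure Arc (Loc : Type u) (Cmd : Type v) where
  src : Loc
  cmd : Cmd
  dst : Loc

/-- A concurrent program `(St, Q_1 ‖ ⋯ ‖ Q_K)`. Process `i` is a synchronization skeleton with local
states `Loc i`, arcs `arcs i` and valuation `val i`, which tells its local states apart. The sets
`AP i` of atomic propositions are disjoint: the propositions of the program are the pairs `⟨i, p⟩`. -/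
structure Program (K : ℕ) (AP : Fin K → Type u) where
  Loc : Fin K → Type u
  val : ∀ i, Loc i → Set (AP i)
  Var : Type u
  Dom : Var → Type u
  arcs : ∀ i, Set (Arc (Loc i) (GuardedCommand (GlobalState Loc Dom) (∀ x, Dom x)))
  init : Set (GlobalState Loc Dom)
  finite_loc : ∀ i, Finite (Loc i)
  finite_var : Finite Var
  finite_dom : ∀ x, Finite (Dom x)
  val_injective : ∀ i, Injective (val i)

namespace Program

variable {K : ℕ} {AP : Fin K → Type u} (Q : Program K AP)

abbrev State : Type u := GlobalState Q.Loc Q.Dom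

/-- The next-state relation: some arc of process `i` that starts in its current local state has a true
guard, and is executed. -/
def next (s : Q.State) (i : Fin K) (t : Q.State) : Prop :=
  ∃ a ∈ Q.arcs i, s.loc i = a.src ∧ a.cmd.guard s ∧
    t.loc = update s.loc i a.dst ∧ t.var = a.cmd.action s

/-- The set of atomic propositions that are true in a global state. -/
def label (s : Q.State) : Set (Σ i, AP i) := {p | p.2 ∈ Q.val p.1 (s.loc p.1)}

/-- The global state transition diagram `M_Q`. -/
def diagram : Kripke (Fin K) (Σ i, AP i) := gstd Q.init Q.next Q.label

end Program

/-! ## Programs in pairwise normal form -/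

/-- A program in pairwise normal form, with interconnection relation `I`. For each pair `e = {i, j}`
of neighbours there is a set `Var e` of variables shared by `i` and `j`. An arc of process `i` is
labelled with `⊗_{j ∈ I(i)} ⊕_l (B_{j,l} → A_{j,l})`: one list of alternative guarded commands per
neighbour `j`, where `B_{j,l}` and `A_{j,l}` read only the variables shared by `i` and `j` and the
atomic propositions of `j`, and `A_{j,l}` updates only the variables shared by `i` and `j`. -/
structure PairwiseProgram (K : ℕ) (AP : Fin K → Type u) where
  I : SimpleGraph (Fin K)
  Loc : Fin K → Type u
  val : ∀ i, Loc i → Set (AP i)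
  Var : I.edgeSet → Type u
  Dom : ∀ e, Var e → Type u
  arcs : ∀ i, Set (Arc (Loc i) (∀ j, (h : I.Adj i j) →
    List (GuardedCommand ((∀ x, Dom ⟨s(i, j), h⟩ x) × Set (AP j)) (∀ x, Dom ⟨s(i, j), h⟩ x))))
  init : Set (GlobalState Loc (fun e => ∀ x, Dom e x))
  finite_loc : ∀ i, Finite (Loc i)
  finite_var : ∀ e, Finite (Var e)
  finite_dom : ∀ e x, Finite (Dom e x)
  finite_arcs : ∀ i, (arcs i).Finite

namespace PairwiseProgram

variable {K : ℕ} {AP : Fin K → Type u} (P : PairwiseProgram K AP)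

abbrev State : Type u := GlobalState P.Loc (fun e => ∀ x, P.Dom e x)

/-- What process `i` may read when it interacts with its neighbour `j`. -/
def view (s : P.State) {i j : Fin K} (h : P.I.Adj i j) :
    (∀ x, P.Dom ⟨s(i, j), h⟩ x) × Set (AP j) :=
  (s.var ⟨s(i, j), h⟩, P.val j (s.loc j))

/-- The next-state relation: for some arc of process `i` that starts in its current local state, one
alternative with a true guard is chosen for every neighbour (`⊕`), and the chosen commands are executed
simultaneously (`⊗`). Variables that process `i` does not share keep their values. -/
def next (s : P.State) (i : Fin K) (t : P.State) : Prop :=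
  ∃ a ∈ P.arcs i, s.loc i = a.src ∧ t.loc = update s.loc i a.dst ∧
    (∀ j, ∀ h : P.I.Adj i j, ∃ g ∈ a.cmd j h,
      g.guard (P.view s h) ∧ t.var ⟨s(i, j), h⟩ = g.action (P.view s h)) ∧
    ∀ e : P.I.edgeSet, i ∉ (e : Sym2 (Fin K)) → t.var e = s.var e

/-- The set of atomic propositions that are true in a global state. -/
def label (s : P.State) : Set (Σ i, AP i) := {p | p.2 ∈ P.val p.1 (s.loc p.1)}

/-- The global state transition diagram of `P`. -/
def diagram : Kripke (Fin K) (Σ i, AP i) := gstd P.init P.next P.label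

end PairwiseProgram

/-! ## CTL* -/

mutual
  /-- State formulas of CTL*, i.e. the formulas of CTL*. -/
  inductive CTLStar (A : Type u) : Type u
    | tt : CTLStar A
    | atom : A → CTLStar A
    | neg : CTLStar A → CTLStar A
    | and : CTLStar A → CTLStar A → CTLStar A
    | ex : CTLStarPath A → CTLStar A
  /-- Path formulas of CTL*. -/
  inductive CTLStarPath (A : Type u) : Type u
    | state : CTLStar A → CTLStarPath A
    | neg : CTLStarPath A → CTLStarPath A
    | and : CTLStarPath A → CTLStarPath A → CTLStarPath A
    | next : CTLStarPath A → CTLStarPath A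
    | until : CTLStarPath A → CTLStarPath A → CTLStarPath A
end

/-- A sequence of states with `len` steps, finite or infinite; entries beyond `len` are irrelevant. -/
structure StatePath (σ : Type u) where
  at' : ℕ → σ
  len : ℕ∞

/-- The path without its first `n` steps. -/
def StatePath.drop {σ : Type u} (p : StatePath σ) (n : ℕ) : StatePath σ where
  at' k := p.at' (n + k)
  len := p.len - n

/-- The two customary notions of a fullpath, which differ only if there are states without successor:
the infinite paths, or all maximal paths (the infinite ones and those that end in such a state). -/
inductive FullpathKind
  | infinite
  | maximal

namespace Kripke

variable {ι : Type v} {A : Type u}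

/-- `p` is a fullpath of `M`. -/
def IsFullpath (M : Kripke.{u, v, w} ι A) (kind : FullpathKind) (p : StatePath M.State) : Prop :=
  (∀ k : ℕ, (k : ℕ∞) < p.len → ∃ i, M.trans (p.at' k) i (p.at' (k + 1))) ∧
  (∀ n : ℕ, p.len = n → kind = .maximal ∧ ¬ ∃ i t, M.trans (p.at' n) i t)

mutual
  /-- `M, s ⊨ f`. -/
  def sat (M : Kripke.{u, v, w} ι A) (kind : FullpathKind) (s : M.State) : CTLStar A → Prop
    | .tt => True
    | .atom a => a ∈ M.label s
    | .neg f => ¬ sat M kind s f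
    | .and f g => sat M kind s f ∧ sat M kind s g
    | .ex g => ∃ p : StatePath M.State, M.IsFullpath kind p ∧ p.at' 0 = s ∧ satPath M kind p g
  /-- `M, p ⊨ g`. -/
  def satPath (M : Kripke.{u, v, w} ι A) (kind : FullpathKind) (p : StatePath M.State) :
      CTLStarPath A → Prop
    | .state f => sat M kind (p.at' 0) f
    | .neg g => ¬ satPath M kind p g
    | .and g h => satPath M kind p g ∧ satPath M kind p h
    | .next g => 1 ≤ p.len ∧ satPath M kind (p.drop 1) g
    | .until g h => ∃ n : ℕ, (n : ℕ∞) ≤ p.len ∧ satPath M kind (p.drop n) h ∧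
        ∀ k < n, satPath M kind (p.drop k) g
end

/-- `M ⊨ f`: the formula holds in all initial states. -/
def Models (M : Kripke.{u, v, w} ι A) (kind : FullpathKind) (f : CTLStar A) : Prop :=
  ∀ s ∈ M.init, M.sat kind s f

end Kripke

/-! ## From `Q` to `PP` -/

/-- The cyclic order `0 <ₒ 1 <ₒ 2 <ₒ 0` on timestamps. -/
def tsLt (t t' : Fin 3) : Prop := (t = 0 ∧ t' = 1) ∨ (t = 1 ∧ t' = 2) ∨ (t = 2 ∧ t' = 0)

instance (t t' : Fin 3) : Decidable (tsLt t t') := by unfold tsLt; infer_instance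

/-- The new timestamp: `t` if `t >ₒ t'`, and otherwise the value `r` with `r >ₒ t'`. -/
def tsStep (t t' : Fin 3) : Fin 3 := if tsLt t' t then t else t' + 1

theorem tsStep_table : tsStep 0 1 = 2 ∧ tsStep 1 2 = 0 ∧ tsStep 2 0 = 1 := by decide

theorem tsLt_tsStep : ∀ t t' : Fin 3, tsLt t' (tsStep t t') := by decide

/-- The variables of `PP` that are shared by the pair `e`. For `e = {w, w'}`, `copy w x` is
`x_{ww'}^w` and `tv w` is `tv_{ww'}^w`; the variables `selfCopy w x = x_{ww}^w` and
`selfTv w = tv_{ww}^w` are shared by `w` and the process `l w` chosen for `w`. -/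
inductive PPVar {K : ℕ} (l : Fin K → Fin K) (V : Type u) (e : Sym2 (Fin K)) : Type u
  | copy (w : Fin K) (hw : w ∈ e) (x : V) : PPVar l V e
  | tv (w : Fin K) (hw : w ∈ e) : PPVar l V e
  | selfCopy (w : Fin K) (hw : e = s(w, l w)) (x : V) : PPVar l V e
  | selfTv (w : Fin K) (hw : e = s(w, l w)) : PPVar l V e

theorem PPVar.finite {K : ℕ} (l : Fin K → Fin K) (V : Type u) (e : Sym2 (Fin K)) [Finite V] :
    Finite (PPVar l V e) := by
  let f : PPVar l V e → (Fin K × V) ⊕ Fin K ⊕ (Fin K × V) ⊕ Fin K := fun y => match y with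
    | .copy w _ x => .inl (w, x)
    | .tv w _ => .inr (.inl w)
    | .selfCopy w _ x => .inr (.inr (.inl (w, x)))
    | .selfTv w _ => .inr (.inr (.inr w))
  refine Finite.of_injective f ?_
  intro a b h
  cases a <;> cases b <;> simp_all [f]

namespace Program

variable {K : ℕ} {AP : Fin K → Type u} (Q : Program K AP)

theorem finite_state : Finite Q.State := by
  have := Q.finite_loc
  have := Q.finite_var
  have := Q.finite_dom
  refine Finite.of_injective (fun s : Q.State => (s.loc, s.var)) ?_
  intro a b h
  simp only [Prod.mk.injEq] at h
  exact GlobalState.ext h.1 h.2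

/-- The indices of the processes with a transition of `M_Q` into `s`. -/
def inProcs (s : Q.State) : Set (Fin K) := {i | ∃ s', Q.diagram.trans s' i s}

/-- The structure `M'_Q` in which all transitions into a state have the same process index: a state
`s` of `M_Q` is split into one copy `(s, i)` for each `i` in `inProcs s`, and is kept as `(s, first)`
if it has no incoming transition. Thus `in(s, i) = i`. -/
def splitDiagram (first : Fin K) : Kripke (Fin K) (Σ i, AP i) where
  State := Q.State × Fin K
  init := {u | u.1 ∈ Q.diagram.init ∧ (u.2 ∈ Q.inProcs u.1 ∨ Q.inProcs u.1 = ∅ ∧ u.2 = first)}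
  states := {u | u.1 ∈ Q.diagram.states ∧ (u.2 ∈ Q.inProcs u.1 ∨ Q.inProcs u.1 = ∅ ∧ u.2 = first)}
  trans u i v :=
    (u.2 ∈ Q.inProcs u.1 ∨ Q.inProcs u.1 = ∅ ∧ u.2 = first) ∧ Q.diagram.trans u.1 i v.1 ∧ v.2 = i
  label u := Q.label u.1

/-- The range of each variable of `PP`: that of `x` for the copies of `x`, and timestamp vectors. -/
abbrev ppDom (l : Fin K → Fin K) {e : Sym2 (Fin K)} : PPVar l Q.Var e → Type u
  | .copy _ _ x => Q.Dom x
  | .tv _ _ => ULift (Fin K → Fin 3)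
  | .selfCopy _ _ x => Q.Dom x
  | .selfTv _ _ => ULift (Fin K → Fin 3)

/-- The initial timestamps `t_i^j`, which make `c` the last process; `X` is arbitrary. -/
def initTs (X : Fin K → Fin K → Fin 3) (c i j : Fin K) : Fin 3 :=
  if i = c ∧ j ≠ c then 1 else if i ≠ c ∧ j = c then 0 else X i j

/-- The part of the guard for source `u = (s, c)` that reads the variables `tv` and `xs` written by
process `j`. For `j = c`, `xs` must be the values of the variables of `Q` in `s`. The condition
`last = c`, i.e. `t_c^j >ₒ t_j^c` for all `j ≠ c`, is put into disjunctive normal form; the disjuncts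
are indexed by `m`, and the disjunct `m` says `t_c^j = m_j + 1` and `t_j^c = m_j` for all `j ≠ c`. -/
def ppLit (u : Q.State × Fin K) (m : Fin K → Fin 3) (j : Fin K)
    (tv : Fin K → Fin 3) (xs : ∀ x, Q.Dom x) : Prop :=
  (j = u.2 → (∀ k, k ≠ u.2 → tv k = m k + 1) ∧ ∀ x, xs x = u.1.var x) ∧
  (j ≠ u.2 → tv u.2 = m j)

/-- The guarded command `BB → AA` of process `i` for its interaction with `j`, on an arc that emulates
the transition `(u, i, v)` of `M'_Q` and changes the timestamps of `i` from `d` to `d'`. -/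
def ppCommand (l : Fin K → Fin K) (i : Fin K) (u v : Q.State × Fin K)
    (m d d' : Fin K → Fin 3) (j : Fin K) :
    GuardedCommand ((∀ x : PPVar l Q.Var s(i, j), Q.ppDom l x) × Set (AP j))
      (∀ x : PPVar l Q.Var s(i, j), Q.ppDom l x) where
  guard r :=
    r.2 = Q.val j (u.1.loc j) ∧
    Q.ppLit u m j (r.1 (.tv j (Sym2.mem_mk_right i j))).down
      (fun x => r.1 (.copy j (Sym2.mem_mk_right i j) x)) ∧
    (∀ h : s(i, j) = s(i, l i),
      Q.ppLit u m i (r.1 (.selfTv i h)).down (fun x => r.1 (.selfCopy i h x))) ∧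
    tsStep (d j) ((r.1 (.tv j (Sym2.mem_mk_right i j))).down i) = d' j
  action r y :=
    let newTv : Fin K → Fin 3 :=
      update d' j (tsStep (d j) ((r.1 (.tv j (Sym2.mem_mk_right i j))).down i))
    match y with
    | .copy w hw x => if w = i then v.1.var x else r.1 (.copy w hw x)
    | .tv w hw => if w = i then ⟨newTv⟩ else r.1 (.tv w hw)
    | .selfCopy w hw x => if w = i then v.1.var x else r.1 (.selfCopy w hw x)
    | .selfTv w hw => if w = i then ⟨newTv⟩ else r.1 (.selfTv w hw)

/-- The arc of `PP_i` for the transition `(u, i, v)` of `M'_Q`, the disjunct `m`, and the timestamps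
`d` and `d'` in its end points. -/
def ppArc (l : Fin K → Fin K) (i : Fin K) (u v : Q.State × Fin K) (m d d' : Fin K → Fin 3) :
    Arc (Q.Loc i × (Fin K → Fin 3)) (∀ j, (⊤ : SimpleGraph (Fin K)).Adj i j →
      List (GuardedCommand ((∀ x : PPVar l Q.Var s(i, j), Q.ppDom l x) × Set (AP j))
        (∀ x : PPVar l Q.Var s(i, j), Q.ppDom l x))) where
  src := (u.1.loc i, d)
  cmd j _ := [Q.ppCommand l i u v m d d' j]
  dst := (v.1.loc i, d')

/-- The initial state of `PP` for the initial state `u` of `M'_Q`. -/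
def ppInit (l : Fin K → Fin K) (X : Q.State × Fin K → Fin K → Fin K → Fin 3)
    (u : Q.State × Fin K) :
    GlobalState (fun i => Q.Loc i × (Fin K → Fin 3))
      (fun e : (⊤ : SimpleGraph (Fin K)).edgeSet => ∀ x : PPVar l Q.Var e, Q.ppDom l x) where
  loc i := (u.1.loc i, initTs (X u) u.2 i)
  var _ y := match y with
    | .copy _ _ x => u.1.var x
    | .tv w _ => ⟨initTs (X u) u.2 w⟩
    | .selfCopy _ _ x => u.1.var x
    | .selfTv w _ => ⟨initTs (X u) u.2 w⟩

/-- The program `PP` built from `Q`. A local state of `PP_i` is a local state of `Q_i` together with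
the timestamps `t_i^1, …, t_i^K`, and has the atomic propositions of the former. The construction
chooses processes `l i` different from `i`, and arbitrary values `X` for irrelevant initial timestamps. -/
abbrev pp (first : Fin K) (l : Fin K → Fin K) (X : Q.State × Fin K → Fin K → Fin K → Fin 3) :
    PairwiseProgram K AP where
  I := ⊤
  Loc i := Q.Loc i × (Fin K → Fin 3)
  val i r := Q.val i r.1
  Var e := PPVar l Q.Var e
  Dom _ x := Q.ppDom l x
  arcs i := {a | ∃ u v m d d', (Q.splitDiagram first).trans u i v ∧ a = Q.ppArc l i u v m d d'}
  init := {r | ∃ u ∈ (Q.splitDiagram first).init, r = Q.ppInit l X u}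
  finite_loc i := by
    have := Q.finite_loc i
    infer_instance
  finite_var e := by
    have := Q.finite_var
    exact PPVar.finite l Q.Var e
  finite_dom e x := by
    have := Q.finite_dom
    cases x <;> simp only [ppDom] <;> infer_instance
  finite_arcs i := by
    have := Q.finite_state
    let f : ((Q.State × Fin K) × (Q.State × Fin K) ×
        (Fin K → Fin 3) × (Fin K → Fin 3) × (Fin K → Fin 3)) → _ :=
      fun z => Q.ppArc l i z.1 z.2.1 z.2.2.1 z.2.2.2.1 z.2.2.2.2
    refine (Set.finite_range f).subset ?_
    rintro a ⟨u, v, m, d, d', -, rfl⟩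
    exact ⟨(u, v, m, d, d'), rfl⟩

end Program

-- CTL* cannot distinguish bisimilar structures, for either kind of fullpath, so it suffices to
-- exhibit a bisimulation between `M_Q` and `M_PP` that covers the initial states on both sides.
-- Relate `s` to a reachable state `r` of `PP` if, for some `c`, `r` represents the copy `(s, c)` of
-- `s` (`Represents`): process `c` moved last, as its timestamps record, and its copies of the
-- variables are current. Other processes may hold stale copies.
--
-- Transitions lift (`Represents.exists_next`): every transition from `(s, c)` has an arc with the
-- timestamps and the disjunct `m` found in `r`. Its execution puts the timestamps of the mover `i`
-- ahead of all others, so that `i` becomes the last process (`Represents.advance`).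
--
-- Steps of `PP` project (`Represents.exists_trans`): the guards of an executed arc determine the
-- copy `(s, c)` completely. Hence the arc was built from a transition that leaves exactly this
-- copy.

/-! ## Bisimulations preserve CTL* -/

namespace Kripke

variable {ι : Type v} {A : Type u}

/-- A bisimulation between two Kripke structures; the labels of the transitions are ignored. -/
structure IsBisimulation (M N : Kripke.{u, v, w} ι A)
    (R : M.State → N.State → Prop) : Prop where
  label_eq : ∀ {s t}, R s t → M.label s = N.label t
  forth : ∀ {s t i s'}, R s t → M.trans s i s' → ∃ j t', N.trans t j t' ∧ R s' t'
  back : ∀ {s t j t'}, R s t → N.trans t j t' → ∃ i s', M.trans s i s' ∧ R s' t'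

variable {M N : Kripke.{u, v, w} ι A} {R : M.State → N.State → Prop}

theorem IsBisimulation.flip (h : IsBisimulation M N R) : IsBisimulation N M (flip R) where
  label_eq hr := (h.label_eq hr).symm
  forth hr ht := h.back hr ht
  back hr ht := h.forth hr ht

/-- Two state paths of the same length that are related pointwise. -/
def PathRel (R : M.State → N.State → Prop) (p : StatePath M.State) (q : StatePath N.State) : Prop :=
  p.len = q.len ∧ ∀ k : ℕ, (k : ℕ∞) ≤ p.len → R (p.at' k) (q.at' k)

theorem PathRel.drop {p : StatePath M.State} {q : StatePath N.State} (h : PathRel R p q) {n : ℕ}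
    (hn : (n : ℕ∞) ≤ p.len) : PathRel R (p.drop n) (q.drop n) := by
  refine ⟨by simp [StatePath.drop, h.1], fun k hk => h.2 (n + k) ?_⟩
  have hk : (k : ℕ∞) ≤ p.len - n := hk
  push_cast
  calc (n : ℕ∞) + k ≤ n + (p.len - n) := by gcongr
    _ = p.len := add_tsub_cancel_of_le hn

/-- The path is built by choosing matching successors recursively. If it is finite, it ends without
successor because `back` would otherwise give one to the end of `p`. -/
theorem IsBisimulation.exists_fullpath (h : IsBisimulation M N R) {kind : FullpathKind}
    {p : StatePath M.State} (hp : M.IsFullpath kind p) {t : N.State} (ht : R (p.at' 0) t) :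
    ∃ q : StatePath N.State, N.IsFullpath kind q ∧ q.at' 0 = t ∧ PathRel R p q := by
  classical
  -- The default value `x` occurs only beyond the length of `p`, where entries are irrelevant.
  let succ : ℕ → N.State → N.State := fun k x =>
    if hx : ∃ y, (∃ j, N.trans x j y) ∧ R (p.at' (k + 1)) y then hx.choose else x
  let q : ℕ → N.State := fun n => Nat.rec t succ n
  have hstep : ∀ k : ℕ, (k : ℕ∞) < p.len → R (p.at' k) (q k) →
      (∃ j, N.trans (q k) j (q (k + 1))) ∧ R (p.at' (k + 1)) (q (k + 1)) := by
    intro k hk hr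
    obtain ⟨i, hi⟩ := hp.1 k hk
    obtain ⟨j, y, hy, hry⟩ := h.forth hr hi
    have hx : ∃ y, (∃ j, N.trans (q k) j y) ∧ R (p.at' (k + 1)) y := ⟨y, ⟨j, hy⟩, hry⟩
    have hq : q (k + 1) = hx.choose := dif_pos hx
    rw [hq]
    exact hx.choose_spec
  have hrel : ∀ k : ℕ, (k : ℕ∞) ≤ p.len → R (p.at' k) (q k) := by
    intro k
    induction k with
    | zero => exact fun _ => ht
    | succ k ih =>
      intro hk
      have hlt : (k : ℕ∞) < p.len := lt_of_lt_of_le (by exact_mod_cast k.lt_succ_self) hk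
      exact (hstep k hlt (ih hlt.le)).2
  refine ⟨⟨q, p.len⟩, ⟨fun k hk => (hstep k hk (hrel k hk.le)).1, fun n hn => ?_⟩, rfl, rfl, hrel⟩
  refine ⟨(hp.2 n hn).1, ?_⟩
  rintro ⟨j, y, hy⟩
  obtain ⟨i, s', hs', -⟩ := h.back (hrel n (le_of_eq hn.symm)) hy
  exact (hp.2 n hn).2 ⟨i, s', hs'⟩

-- Simultaneous structural induction. Related paths have equal length, so the length conditions in
-- `next` and `until` agree, and they keep the suffixes within the range where the paths are
-- related.
mutual
  theorem IsBisimulation.sat_iff (h : IsBisimulation M N R) (kind : FullpathKind) :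
      ∀ (f : CTLStar A) {s : M.State} {t : N.State}, R s t → (M.sat kind s f ↔ N.sat kind t f)
    | .tt, _, _, _ => by simp only [sat]
    | .atom a, _, _, hr => by simp only [sat, h.label_eq hr]
    | .neg f, _, _, hr => by
      simp only [sat]
      exact not_congr (h.sat_iff kind f hr)
    | .and f g, _, _, hr => by
      simp only [sat]
      exact and_congr (h.sat_iff kind f hr) (h.sat_iff kind g hr)
    | .ex g, s, t, hr => by
      simp only [sat]
      constructor
      · rintro ⟨p, hp, rfl, hg⟩
        obtain ⟨q, hq, hq0, hpq⟩ := h.exists_fullpath hp hr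
        exact ⟨q, hq, hq0, (h.satPath_iff kind g hpq).1 hg⟩
      · rintro ⟨q, hq, rfl, hg⟩
        obtain ⟨p, hp, hp0, hqp⟩ := h.flip.exists_fullpath hq hr
        exact ⟨p, hp, hp0,
          (h.satPath_iff kind g ⟨hqp.1.symm, fun k hk => hqp.2 k (hqp.1 ▸ hk)⟩).2 hg⟩
  theorem IsBisimulation.satPath_iff (h : IsBisimulation M N R) (kind : FullpathKind) :
      ∀ (g : CTLStarPath A) {p : StatePath M.State} {q : StatePath N.State}, PathRel R p q →
        (M.satPath kind p g ↔ N.satPath kind q g)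
    | .state f, _, _, hr => by
      simp only [satPath]
      exact h.sat_iff kind f (hr.2 0 (by simp))
    | .neg g, _, _, hr => by
      simp only [satPath]
      exact not_congr (h.satPath_iff kind g hr)
    | .and g g', _, _, hr => by
      simp only [satPath]
      exact and_congr (h.satPath_iff kind g hr) (h.satPath_iff kind g' hr)
    | .next g, _, _, hr => by
      simp only [satPath, ← hr.1]
      exact and_congr_right fun hn => h.satPath_iff kind g (hr.drop (by exact_mod_cast hn))
    | .until g g', _, _, hr => by
      simp only [satPath, ← hr.1]
      refine exists_congr fun n => and_congr_right fun hn => and_congr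
        (h.satPath_iff kind g' (hr.drop hn)) (forall₂_congr fun k hk => ?_)
      exact h.satPath_iff kind g (hr.drop (le_trans (by exact_mod_cast hk.le) hn))
end

theorem IsBisimulation.models_iff (h : IsBisimulation M N R)
    (hM : ∀ s ∈ M.init, ∃ t ∈ N.init, R s t) (hN : ∀ t ∈ N.init, ∃ s ∈ M.init, R s t)
    (kind : FullpathKind) (f : CTLStar A) : M.Models kind f ↔ N.Models kind f := by
  constructor
  · intro hf t ht
    obtain ⟨s, hs, hr⟩ := hN t ht
    exact (h.sat_iff kind f hr).1 (hf s hs)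
  · intro hf s hs
    obtain ⟨t, ht, hr⟩ := hM s hs
    exact (h.sat_iff kind f hr).2 (hf t ht)

end Kripke

/-! ## `M_Q` and `M_PP` are bisimilar -/

namespace Program

variable {K : ℕ} {AP : Fin K → Type u} (Q : Program K AP) (l : Fin K → Fin K)

/-- The global states of `PP`. -/
abbrev PPState : Type u :=
  GlobalState (fun i => Q.Loc i × (Fin K → Fin 3))
    (fun e : (⊤ : SimpleGraph (Fin K)).edgeSet => ∀ x : PPVar l Q.Var e, Q.ppDom l x)

variable {Q l}

/-- The state of `PP` reached from `r` when process `i` emulates a transition into `s'` and changes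
its timestamps to `d'`. -/
def ppAdvance (r : Q.PPState l) (i : Fin K) (s' : Q.State) (d' : Fin K → Fin 3) : Q.PPState l where
  loc := update r.loc i (s'.loc i, d')
  var e y := match y with
    | .copy w hw x => if w = i then s'.var x else r.var e (.copy w hw x)
    | .tv w hw => if w = i then ⟨d'⟩ else r.var e (.tv w hw)
    | .selfCopy w hw x => if w = i then s'.var x else r.var e (.selfCopy w hw x)
    | .selfTv w hw => if w = i then ⟨d'⟩ else r.var e (.selfTv w hw)

theorem ppAdvance_var_of_notMem (r : Q.PPState l) (i : Fin K) (s' : Q.State) (d' : Fin K → Fin 3)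
    (e : (⊤ : SimpleGraph (Fin K)).edgeSet) (he : i ∉ (e : Sym2 (Fin K))) :
    (ppAdvance r i s' d').var e = r.var e := by
  have hne : ∀ {w}, w ∈ (e : Sym2 (Fin K)) → w ≠ i := by
    rintro w hw rfl
    exact he hw
  funext y
  match y with
  | .copy w hw x => exact if_neg (hne hw)
  | .tv w hw => exact if_neg (hne hw)
  | .selfCopy w hw x => exact if_neg (hne (hw ▸ Sym2.mem_mk_left w (l w)))
  | .selfTv w hw => exact if_neg (hne (hw ▸ Sym2.mem_mk_left w (l w)))

/-- The command for `j` computes only the `j`-th timestamp and takes the others from `d'`. Since the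
guard forces the computed value to be `d' j`, all pairs receive the same vector `d'`. -/
theorem ppAdvance_var_edge (r : Q.PPState l) (i : Fin K) (u v : Q.State × Fin K)
    (m d d' : Fin K → Fin 3) (j : Fin K) (h : (⊤ : SimpleGraph (Fin K)).Adj i j) (P : Set (AP j))
    (hd : tsStep (d j) ((r.var ⟨s(i, j), h⟩ (.tv j (Sym2.mem_mk_right i j))).down i) = d' j) :
    (ppAdvance r i v.1 d').var ⟨s(i, j), h⟩ =
      (Q.ppCommand l i u v m d d' j).action (r.var ⟨s(i, j), h⟩, P) := by
  funext y
  cases y <;> simp only [ppAdvance, ppCommand, hd, update_eq_self]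

variable (Q l) in
/-- The state `r` of `PP` represents the state `u = (s, c)` of `M'_Q`: process `c` has the latest
timestamps, and its copies of the variables of `Q` hold their values in `s`. -/
structure Represents (first : Fin K) (r : Q.PPState l) (u : Q.State × Fin K) : Prop where
  mem_states : u ∈ (Q.splitDiagram first).states
  loc_eq : ∀ i, (r.loc i).1 = u.1.loc i
  tv_eq : ∀ e w hw, (r.var e (.tv w hw)).down = (r.loc w).2
  selfTv_eq : ∀ e w hw, (r.var e (.selfTv w hw)).down = (r.loc w).2
  last_eq : ∀ j, j ≠ u.2 → (r.loc u.2).2 j = (r.loc j).2 u.2 + 1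
  copy_eq : ∀ e hw x, r.var e (.copy u.2 hw x) = u.1.var x
  selfCopy_eq : ∀ e hw x, r.var e (.selfCopy u.2 hw x) = u.1.var x

variable {first : Fin K} {r : Q.PPState l} {u v : Q.State × Fin K} {i : Fin K}

-- Transitions of `M'_Q` emulated by `PP`

theorem loc_eq_update_of_trans (h : (Q.splitDiagram first).trans u i v) :
    v.1.loc = update u.1.loc i (v.1.loc i) := by
  obtain ⟨-, ⟨-, -, a, -, -, -, ha, -⟩, -⟩ := h
  rw [ha, update_self]

/-- In the cyclic order on three values, only one value lies above `t'`, so both cases of the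
definition agree. -/
theorem tsStep_eq_add_one (t t' : Fin 3) : tsStep t t' = t' + 1 := by
  revert t t'
  decide

theorem Represents.advance (hr : Represents Q l first r u)
    (h : (Q.splitDiagram first).trans u i v) (d' : Fin K → Fin 3)
    (hd : ∀ j, j ≠ i → tsStep ((r.loc i).2 j) ((r.loc j).2 i) = d' j) :
    Represents Q l first (ppAdvance r i v.1 d') v := by
  obtain ⟨t, c⟩ := v
  obtain ⟨hu, ht, rfl⟩ := id h
  refine ⟨⟨ht.2.1, Or.inl ⟨u.1, ht⟩⟩, fun j => ?_, fun e w hw => ?_, fun e w hw => ?_, fun j hj => ?_,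
    fun e hw x => if_pos rfl, fun e hw x => if_pos rfl⟩
  · have hloc := congrFun (loc_eq_update_of_trans h) j
    rcases eq_or_ne j c with rfl | hj
    · simp [ppAdvance]
    · simpa [ppAdvance, hj, hr.loc_eq] using hloc.symm
  · rcases eq_or_ne w c with rfl | hj
    · simp [ppAdvance]
    · simpa [ppAdvance, hj] using hr.tv_eq e w hw
  · rcases eq_or_ne w c with rfl | hj
    · simp [ppAdvance]
    · simpa [ppAdvance, hj] using hr.selfTv_eq e w hw
  -- The timestamps of `j` do not change, and `step` places those of the mover one above them.
  · have hj : j ≠ c := hj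
    simp [ppAdvance, hj, ← hd j hj, tsStep_eq_add_one]

variable {X : Q.State × Fin K → Fin K → Fin K → Fin 3}

theorem Represents.exists_next (hr : Represents Q l first r u)
    (h : (Q.splitDiagram first).trans u i v) :
    ∃ r' : Q.PPState l, (Q.pp first l X).next r i r' ∧ Represents Q l first r' v := by
  set d' : Fin K → Fin 3 := fun j => tsStep ((r.loc i).2 j) ((r.loc j).2 i) with hd'
  -- The disjunct is `m_k = t_k^c`; `last_eq` is then what the test of process `c` requires.
  have hlit : ∀ j tv xs, tv = (r.loc j).2 → (j = u.2 → ∀ x, xs x = u.1.var x) →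
      Q.ppLit u (fun k => (r.loc k).2 u.2) j tv xs := by
    rintro j tv xs rfl hxs
    refine ⟨fun hj => ⟨fun k hk => ?_, hxs hj⟩, fun _ => rfl⟩
    subst hj
    exact hr.last_eq k hk
  refine ⟨ppAdvance r i v.1 d', ⟨Q.ppArc l i u v (fun k => (r.loc k).2 u.2) (r.loc i).2 d',
    ⟨u, v, _, _, _, h, rfl⟩, ?_, rfl, fun j hj => ⟨_, List.mem_singleton_self _, ?_, ?_⟩,
    fun e he => ppAdvance_var_of_notMem r i v.1 d' e he⟩, hr.advance h d' fun _ _ => rfl⟩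
  · exact Prod.ext (hr.loc_eq i) rfl
  · refine ⟨congrArg (Q.val j) (hr.loc_eq j), hlit _ _ _ (hr.tv_eq _ _ _) ?_,
      fun hi => hlit _ _ _ (hr.selfTv_eq ⟨s(i, j), hj⟩ _ _) ?_, ?_⟩
    · rintro rfl x
      exact hr.copy_eq _ _ x
    · intro hc x
      subst hc
      exact hr.selfCopy_eq ⟨s(u.2, j), hj⟩ _ x
    · simp only [PairwiseProgram.view, hr.tv_eq, hd']
  · refine ppAdvance_var_edge r i u v _ _ d' j hj _ ?_
    simp only [hr.tv_eq, hd']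

-- Steps of `PP` come from transitions of `M'_Q`

theorem eq_of_add_one_eq {a b : Fin 3} : a = b + 1 → b ≠ a + 1 := by
  revert a b
  decide

theorem Represents.exists_trans (hl : ∀ i, l i ≠ i) (hr : Represents Q l first r u)
    {r' : Q.PPState l} (h : (Q.pp first l X).next r i r') :
    ∃ v, (Q.splitDiagram first).trans u i v ∧ Represents Q l first r' v := by
  obtain ⟨_, ⟨u', v, m, d, d', huv, rfl⟩, hsrc, hloc, hcmd, hvar⟩ := h
  have hcmd' : ∀ j, ∀ hj : (⊤ : SimpleGraph (Fin K)).Adj i j,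
      (Q.ppCommand l i u' v m d d' j).guard ((Q.pp first l X).view r hj) ∧
      r'.var ⟨s(i, j), hj⟩ =
        (Q.ppCommand l i u' v m d d' j).action ((Q.pp first l X).view r hj) := by
    intro j hj
    obtain ⟨g, hg, hg'⟩ := hcmd j hj
    rw [List.mem_singleton.1 hg] at hg'
    exact hg'
  have hadj : ∀ {j}, j ≠ i → (⊤ : SimpleGraph (Fin K)).Adj i j := fun hj => hj.symm
  have hsrc : r.loc i = (u'.1.loc i, d) := hsrc
  -- The tests of the timestamp vectors and copies of all processes, `i` included.
  have hlit : ∀ j, ∃ xs, Q.ppLit u' m j (r.loc j).2 xs ∧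
      (j = u.2 → ∀ x, xs x = u.1.var x) := by
    intro j
    -- Process `i` tests its own vector and copies through the self variables, which lie on the edge
    -- to `l i`; this is where `l i ≠ i` matters.
    rcases eq_or_ne j i with rfl | hj
    · obtain ⟨-, -, hs, -⟩ := (hcmd' (l j) (hadj (hl j))).1
      refine ⟨_, hr.selfTv_eq ⟨s(j, l j), hadj (hl j)⟩ j rfl ▸ hs rfl, ?_⟩
      rintro rfl x
      exact hr.selfCopy_eq ⟨s(u.2, l u.2), hadj (hl _)⟩ _ x
    · obtain ⟨-, hs, -, -⟩ := (hcmd' j (hadj hj)).1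
      refine ⟨_, hr.tv_eq ⟨s(i, j), hadj hj⟩ j (Sym2.mem_mk_right i j) ▸ hs, ?_⟩
      rintro rfl x
      exact hr.copy_eq _ _ x
  have hlast : u'.2 = u.2 := by
    -- Let `c = u.2` and `c' = u'.2`. The common `m` links the tests of the two processes to
    -- `t_{c'}^c = t_c^{c'} + 1`, whereas `last_eq` gives `t_c^{c'} = t_{c'}^c + 1`. Together these
    -- say `2 = 0` modulo 3.
    by_contra hne
    obtain ⟨xs, hxs, -⟩ := hlit u.2
    obtain ⟨ys, hys, -⟩ := hlit u'.2
    have h1 := (hys.1 rfl).1 u.2 (Ne.symm hne)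
    rw [← hxs.2 (Ne.symm hne)] at h1
    exact eq_of_add_one_eq h1 (hr.last_eq u'.2 hne)
  have huu : u' = u := by
    refine Prod.ext (GlobalState.ext (funext fun j => ?_) (funext fun x => ?_)) hlast
    · rw [← hr.loc_eq j]
      rcases eq_or_ne j i with rfl | hj
      · rw [hsrc]
      -- The guard sees only the propositions of `j`; these identify its local state in `Q`.
      · exact (Q.val_injective j (hcmd' j (hadj hj)).1.1).symm
    · obtain ⟨xs, hxs, hxs'⟩ := hlit u.2
      rw [← hxs' rfl x, (hxs.1 hlast.symm).2 x]
  subst huu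
  have hd : ∀ j, j ≠ i → tsStep ((r.loc i).2 j) ((r.loc j).2 i) = d' j := by
    intro j hj
    obtain ⟨-, -, -, hs⟩ := (hcmd' j (hadj hj)).1
    rw [hsrc, ← hr.tv_eq ⟨s(i, j), hadj hj⟩ j (Sym2.mem_mk_right i j)]
    exact hs
  have hr' : r' = ppAdvance r i v.1 d' := by
    refine GlobalState.ext hloc (funext fun e => ?_)
    by_cases he : i ∈ (e : Sym2 (Fin K))
    · obtain ⟨e, hedge⟩ := e
      obtain ⟨j, rfl⟩ := Sym2.mem_iff_exists.1 he
      have hj : j ≠ i := (SimpleGraph.mem_edgeSet _ |>.1 hedge).ne'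
      rw [(hcmd' j hedge).2]
      refine (ppAdvance_var_edge r i u' v m d d' j hedge _ ?_).symm
      rw [hr.tv_eq, ← hd j hj, hsrc]
    · rw [hvar e he, ppAdvance_var_of_notMem r i v.1 d' e he]
  exact ⟨v, huv, hr' ▸ hr.advance huv d' hd⟩

-- The bisimulation and the main theorem

theorem represents_ppInit (hu : u ∈ (Q.splitDiagram first).init) :
    Represents Q l first (Q.ppInit l X u) u where
  mem_states := ⟨.init hu.1, hu.2⟩
  loc_eq _ := rfl
  tv_eq _ _ _ := rfl
  selfTv_eq _ _ _ := rfl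
  last_eq j hj := by simp [ppInit, initTs, hj]
  copy_eq _ _ _ := rfl
  selfCopy_eq _ _ _ := rfl

/-- The index `c` can be forgotten because all copies of `s` have the same outgoing transitions.
Reachability of `r` is part of the relation because the transitions of a diagram join reachable
states only. -/
theorem isBisimulation_pp (hl : ∀ i, l i ≠ i) :
    Kripke.IsBisimulation Q.diagram (Q.pp first l X).diagram
      fun s (r : Q.PPState l) => r ∈ (Q.pp first l X).diagram.states ∧
        ∃ c, Represents Q l first r (s, c) where
  label_eq := by
    rintro s r ⟨-, c, hr⟩
    ext p
    change p.2 ∈ Q.val p.1 (s.loc p.1) ↔ p.2 ∈ Q.val p.1 (r.loc p.1).1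
    rw [hr.loc_eq]
  forth := by
    rintro s r i s' ⟨hreach, c, hr⟩ ht
    obtain ⟨r', hnext, hr'⟩ := hr.exists_next (X := X) (v := (s', i)) ⟨hr.mem_states.2, ht, rfl⟩
    have hreach' := Reachable.step hreach hnext
    exact ⟨i, r', ⟨hreach, hreach', hnext⟩, hreach', i, hr'⟩
  back := by
    rintro s r i r' ⟨-, c, hr⟩ ⟨-, hreach', hnext⟩
    obtain ⟨⟨s', c'⟩, ht, hr'⟩ := hr.exists_trans hl hnext
    exact ⟨i, s', ht.2.1, hreach', c', hr'⟩

theorem exists_mem_splitDiagram_init {s : Q.State} (hs : s ∈ Q.init) (first : Fin K) :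
    ∃ c, (s, c) ∈ (Q.splitDiagram first).init := by
  rcases (Q.inProcs s).eq_empty_or_nonempty with h | ⟨c, hc⟩
  · exact ⟨first, hs, .inr ⟨h, rfl⟩⟩
  · exact ⟨c, hs, .inl hc⟩

end Program

theorem mainTheorem4 {K : ℕ} (hK : 2 ≤ K) {AP : Fin K → Type u} (Q : Program K AP)
    (l : Fin K → Fin K) (hl : ∀ i, l i ≠ i)
    (X : Q.State × Fin K → Fin K → Fin K → Fin 3)
    (kind : FullpathKind) (f : CTLStar (Σ i, AP i)) :
    Q.diagram.Models kind f ↔ (Q.pp ⟨0, by omega⟩ l X).diagram.Models kind f := by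
  refine (Program.isBisimulation_pp hl).models_iff (fun s hs => ?_) ?_ kind f
  · obtain ⟨c, hc⟩ := Program.exists_mem_splitDiagram_init hs ⟨0, by omega⟩
    exact ⟨Q.ppInit l X (s, c), ⟨_, hc, rfl⟩, .init ⟨_, hc, rfl⟩, c, Program.represents_ppInit hc⟩
  · rintro _ ⟨⟨s, c⟩, hc, rfl⟩
    exact ⟨s, hc.1, .init ⟨_, hc, rfl⟩, c, Program.represents_ppInit hc⟩
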